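/- Let $d\in\mathbb N$, let $\sigma,\gamma>0$, and let $\alpha=c_\alpha\,\mathcal N(m_\alpha,\Sigma_\alpha)$ and $\beta=c_\beta\,\mathcal N(m_\beta,\Sigma_\beta)$ be scaled Gaussian measures on $\mathbb R^d$, where $c_\alpha,c_\beta>0$, $m_\alpha,m_\beta\in\mathbb R^d$ and the covariance matrices $\Sigma_\alpha,\Sigma_\beta$ are symmetric positive definite. For finite nonnegative measures $\mu,\nu$ let $$D_{\mathrm{KL}}(\mu\|\nu)=\int\log\frac{\mathrm d\mu}{\mathrm d\nu}\,\mathrm d\mu-\int\mathrm d\mu+\int\mathrm d\nu\in[0,+\infty]$$ if $\mu\ll\nu$, and $D_{\mathrm{KL}}(\mu\|\nu)=+\infty$ otherwise. Let $\mathcal M_2^+(\mathbb R^d\times\mathbb R^d)$ be the set of finite nonnegative Borel measures on $\mathbb R^d\times\mathbb R^d$ with finite second moment, and for $\pi\in\mathcal M_2^+(\mathbb R^d\times\mathbb R^d)$ with marginals $\pi_1,\pi_2$ put $$J_3(\pi)=\int\|x_2-x_1\|^2\,\mathrm d\pi(x_1,x_2)+\sigma D_{\mathrm{KL}}(\pi\|\alpha\otimes\beta)+\gamma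 D_{\mathrm{KL}}(\pi_1\|\alpha)+\gamma D_{\mathrm{KL}}(\pi_2\|\beta)\in[0,+\infty].$$ Let $\pi\in\mathcal M_2^+(\mathbb R^d\times\mathbb R^d)$ be arbitrary, with mass $c=\pi(\mathbb R^d\times\mathbb R^d)$, and let $$m=\begin{pmatrix}m_1\\ m_2\end{pmatrix}\in\mathbb R^{2d},\qquad \Sigma=\begin{pmatrix}\Sigma_1&\Sigma_3\\ \Sigma_3^\top&\Sigma_2\end{pmatrix}\in\mathbb R^{2d\times 2d}$$ be the mean and the covariance matrix of the probability measure $\bar\pi=\pi/c$. Put $\pi^{\mathrm G}=c\,\mathcal N(m,\Sigma)$ (where $\mathcal N(m,\Sigma)$ may be degenerate, and $\pi^{\mathrm G}=0$ if $c=0$). Then $\pi^{\mathrm G}\in\mathcal M_2^+(\mathbb R^d\times\mathbb R^d)$ and $$J_3(\pi^{\mathrm G})\le J_3(\pi).$$ -/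

import Mathlib

open MeasureTheory ProbabilityTheory InformationTheory
open scoped ENNReal

namespace EUOT

/-- The Euclidean space `ℝ^d`. -/
abbrev Rd (d : ℕ) : Type := EuclideanSpace ℝ (Fin d)

/-- Membership in `M₂⁺(ℝ^d × ℝ^d)`: a finite nonnegative Borel measure with finite second moment
for the Euclidean norm of `ℝ^d × ℝ^d = ℝ^(2d)`. -/
def IsPlan {d : ℕ} (π : Measure (Rd d × Rd d)) : Prop :=
  IsFiniteMeasure π ∧ ∫⁻ z, (‖z.1‖ₑ ^ 2 + ‖z.2‖ₑ ^ 2) ∂π < ∞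

/-- The (unbalanced) Gaussian measure `c N(m, S)` on `ℝ^d`. -/
noncomputable def scaledGaussian {d : ℕ} (c : ℝ) (m : Rd d) (S : Matrix (Fin d) (Fin d) ℝ) :
    Measure (Rd d) :=
  ENNReal.ofReal c • multivariateGaussian m S

/-- The identification of `ℝ^(2d)`, with coordinates indexed by two copies of `Fin d`, with
`ℝ^d × ℝ^d`. -/
def split {d : ℕ} (w : EuclideanSpace ℝ (Fin d ⊕ Fin d)) : Rd d × Rd d :=
  (WithLp.toLp 2 fun i => w (Sum.inl i), WithLp.toLp 2 fun i => w (Sum.inr i))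

theorem measurable_split {d : ℕ} : Measurable (split (d := d)) := by
  have h : Continuous (split (d := d)) := by
    unfold split
    fun_prop
  exact h.measurable

/-- The Gaussian probability measure `N(m, S)` on `ℝ^d × ℝ^d`, for a joint mean `m = (m₁, m₂)` and
a joint covariance matrix `S`. -/
noncomputable def jointGaussian {d : ℕ} (m : Rd d × Rd d)
    (S : Matrix (Fin d ⊕ Fin d) (Fin d ⊕ Fin d) ℝ) : Measure (Rd d × Rd d) :=
  (multivariateGaussian (WithLp.toLp 2 (Sum.elim m.1 m.2)) S).map split

/-- The normalized measure `π / π(ℝ^d × ℝ^d)`. -/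
noncomputable def normalize {d : ℕ} (π : Measure (Rd d × Rd d)) : Measure (Rd d × Rd d) :=
  (π Set.univ)⁻¹ • π

/-- The joint mean `(m₁, m₂)` of a probability measure on `ℝ^d × ℝ^d`. -/
noncomputable def jointMean {d : ℕ} (P : Measure (Rd d × Rd d)) : Rd d × Rd d :=
  (∫ z, z.1 ∂P, ∫ z, z.2 ∂P)

/-- The joint covariance matrix of a probability measure on `ℝ^d × ℝ^d`, with blocks
`Σ₁ = Cov(x, x)`, `Σ₃ = Cov(x, y)`, `Σ₃ᵀ` and `Σ₂ = Cov(y, y)`. -/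
noncomputable def jointCov {d : ℕ} (P : Measure (Rd d × Rd d)) :
    Matrix (Fin d ⊕ Fin d) (Fin d ⊕ Fin d) ℝ :=
  let S₁ : Matrix (Fin d) (Fin d) ℝ := Matrix.of fun i j => cov[fun z => z.1 i, fun z => z.1 j; P]
  let S₂ : Matrix (Fin d) (Fin d) ℝ := Matrix.of fun i j => cov[fun z => z.2 i, fun z => z.2 j; P]
  let S₃ : Matrix (Fin d) (Fin d) ℝ := Matrix.of fun i j => cov[fun z => z.1 i, fun z => z.2 j; P]
  Matrix.fromBlocks S₁ S₃ S₃.transpose S₂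

/-- The Gaussian plan `π(ℝ^d × ℝ^d) N(m, S)` with the mass of `π` and with the joint mean and the
joint covariance of the normalized plan; it is the zero measure if `π` is. -/
noncomputable def gaussianPlan {d : ℕ} (π : Measure (Rd d × Rd d)) : Measure (Rd d × Rd d) :=
  π Set.univ • jointGaussian (jointMean (normalize π)) (jointCov (normalize π))

/-- The objective of entropic unbalanced optimal transport with quadratic cost, with values in
`[0, ∞]`. -/
noncomputable def objective {d : ℕ} (σ γ : ℝ) (α β : Measure (Rd d)) (π : Measure (Rd d × Rd d)) :
    ℝ≥0∞ :=
  (∫⁻ z, ‖z.2 - z.1‖ₑ ^ 2 ∂π)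
    + ENNReal.ofReal σ * klDiv π (α.prod β)
    + ENNReal.ofReal γ * klDiv (π.map Prod.fst) α
    + ENNReal.ofReal γ * klDiv (π.map Prod.snd) β

end EUOT

/-! Matching mass, mean and covariance fixes the integral of every polynomial of degree at most two.
The transport cost is such a polynomial, so it does not change. For a divergence from a
nondegenerate Gaussian `ν`, let `G` be the Gaussian with the moments of `μ`. If `D(μ‖ν)` is infinite
there is nothing to prove. Otherwise `μ` is absolutely continuous with respect to Lebesgue measure,
charges no hyperplane, and so has a nondegenerate covariance. Then `log (dG/dν)` is quadratic, has
the same integral against `μ` and `G`, and `D(μ‖ν) - D(G‖ν) = D(μ‖G) ≥ 0`.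

This is applied to the joint plan and to both marginals, since linear images preserve equality of
moments and Gaussianity. The main lemmas are `sameMoments_jointGaussian`,
`klDiv_le_klDiv_of_withDensity`, `variance_dual_ne_zero` and `SameMoments.klDiv_gaussian_le`. -/

namespace EUOT

/-! ### Polynomials of degree at most two. -/

section QuadraticFunctions

variable {E F : Type*} [NormedAddCommGroup E] [NormedSpace ℝ E]
  [NormedAddCommGroup F] [NormedSpace ℝ F]

/-- Real functions that are polynomials of degree at most two. -/
def IsQuadratic (q : E → ℝ) : Prop :=
  ∃ (B : E →L[ℝ] E →L[ℝ] ℝ) (L : E →L[ℝ] ℝ) (c : ℝ), ∀ x, q x = B x x + L x + c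

theorem IsQuadratic.continuous {q : E → ℝ} (hq : IsQuadratic q) : Continuous q := by
  obtain ⟨B, L, c, h⟩ := hq
  rw [funext h]
  fun_prop

theorem isQuadratic_const (c : ℝ) : IsQuadratic (fun _ : E => c) :=
  ⟨0, 0, c, by simp⟩

theorem isQuadratic_dual (L : E →L[ℝ] ℝ) : IsQuadratic (fun x => L x) :=
  ⟨0, L, 0, by simp⟩

theorem IsQuadratic.add {p q : E → ℝ} (hp : IsQuadratic p) (hq : IsQuadratic q) :
    IsQuadratic (fun x => p x + q x) := by
  obtain ⟨B, L, c, h⟩ := hp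
  obtain ⟨B', L', c', h'⟩ := hq
  refine ⟨B + B', L + L', c + c', fun x => ?_⟩
  simp only [h, h', add_apply]
  ring

theorem IsQuadratic.const_mul {q : E → ℝ} (hq : IsQuadratic q) (a : ℝ) :
    IsQuadratic (fun x => a * q x) := by
  obtain ⟨B, L, c, h⟩ := hq
  refine ⟨a • B, a • L, a * c, fun x => ?_⟩
  simp only [h, smul_apply, smul_eq_mul]
  ring

theorem IsQuadratic.sub {p q : E → ℝ} (hp : IsQuadratic p) (hq : IsQuadratic q) :
    IsQuadratic (fun x => p x - q x) := by
  simpa [sub_eq_add_neg] using hp.add (hq.const_mul (-1))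

theorem isQuadratic_dual_mul_dual (L₁ L₂ : E →L[ℝ] ℝ) : IsQuadratic (fun x => L₁ x * L₂ x) :=
  ⟨L₁.smulRight L₂, 0, 0, by simp⟩

theorem IsQuadratic.comp_clm {q : F → ℝ} (hq : IsQuadratic q) (A : E →L[ℝ] F) :
    IsQuadratic (fun x => q (A x)) := by
  obtain ⟨B, L, c, h⟩ := hq
  exact ⟨B.bilinearComp A A, L.comp A, c, fun x => by simp [h]⟩

theorem IsQuadratic.comp_add_const {q : E → ℝ} (hq : IsQuadratic q) (b : E) :
    IsQuadratic (fun x => q (x + b)) := by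
  obtain ⟨B, L, c, h⟩ := hq
  -- `B` need not be symmetric, so the two cross terms are kept apart.
  refine ⟨B, L + B b + B.flip b, c + L b + B b b, fun x => ?_⟩
  simp only [h, map_add, add_apply, ContinuousLinearMap.flip_apply]
  ring

theorem isQuadratic_norm_sq {H : Type*} [NormedAddCommGroup H] [InnerProductSpace ℝ H] :
    IsQuadratic (fun x : H => ‖x‖ ^ 2) :=
  ⟨innerSL ℝ, 0, 0, fun x => by simp [innerSL_apply_apply ℝ]⟩

/-- On a finite-dimensional space, a quadratic function is a sum of products of linear forms, a
linear form and a constant. -/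
theorem IsQuadratic.exists_eq_sum [FiniteDimensional ℝ E] {q : E → ℝ} (hq : IsQuadratic q) :
    ∃ (n : ℕ) (L₁ L₂ : Fin n → E →L[ℝ] ℝ) (L : E →L[ℝ] ℝ) (c : ℝ),
      ∀ x, q x = ∑ i, L₁ i x * L₂ i x + L x + c := by
  obtain ⟨B, L, c, h⟩ := hq
  let b := Module.finBasis ℝ E
  refine ⟨_, fun i => LinearMap.toContinuousLinearMap (b.coord i), fun i => B (b i), L, c,
    fun x => ?_⟩
  rw [h]
  congr 2
  -- Only the first argument of `B x x` is expanded in the basis.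
  have hB : B x = ∑ i, b.repr x i • B (b i) := by
    conv_lhs => rw [← b.sum_repr x, map_sum]
    simp_rw [map_smul]
  rw [hB, sum_apply]
  simp

end QuadraticFunctions

/-! ### Equality of moments up to order two. -/

section MomentMatching

variable {E F : Type*} [NormedAddCommGroup E] [NormedSpace ℝ E] [MeasurableSpace E]
  [NormedAddCommGroup F] [NormedSpace ℝ F] [MeasurableSpace F] [BorelSpace F]

theorem memLp_dual_of_memLp_id {μ : Measure E} (hμ : MemLp id 2 μ) (L : E →L[ℝ] ℝ) :
    MemLp (fun x => L x) 2 μ := L.comp_memLp' hμ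

theorem IsQuadratic.integrable [BorelSpace E] [FiniteDimensional ℝ E] {q : E → ℝ} (hq : IsQuadratic q) {μ : Measure E} [IsFiniteMeasure μ]
    (hμ : MemLp id 2 μ) : Integrable q μ := by
  obtain ⟨n, L₁, L₂, L, c, h⟩ := hq.exists_eq_sum
  rw [funext h]
  refine ((integrable_finsetSum _ fun i _ => ?_).add ?_).add (integrable_const c)
  · exact (memLp_dual_of_memLp_id hμ (L₁ i)).integrable_mul (memLp_dual_of_memLp_id hμ (L₂ i))
  · exact (memLp_dual_of_memLp_id hμ L).integrable one_le_two

/-- Two measures with finite second moments whose moments of order at most two are the same. -/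
structure SameMoments (μ ν : Measure E) : Prop where
  left : MemLp id 2 μ
  right : MemLp id 2 ν
  integral_eq : ∀ q : E → ℝ, IsQuadratic q → ∫ x, q x ∂μ = ∫ x, q x ∂ν

theorem SameMoments.map [BorelSpace E] [FiniteDimensional ℝ F] {μ ν : Measure E} (h : SameMoments μ ν) (A : E →L[ℝ] F) :
    SameMoments (μ.map A) (ν.map A) := by
  refine ⟨?_, ?_, fun q hq => ?_⟩
  · rw [memLp_map_measure_iff aestronglyMeasurable_id (by fun_prop)]
    exact A.comp_memLp' h.left
  · rw [memLp_map_measure_iff aestronglyMeasurable_id (by fun_prop)]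
    exact A.comp_memLp' h.right
  · rw [integral_map (by fun_prop) hq.continuous.aestronglyMeasurable,
      integral_map (by fun_prop) hq.continuous.aestronglyMeasurable]
    exact h.integral_eq _ (hq.comp_clm A)

theorem SameMoments.smul {μ ν : Measure E} (h : SameMoments μ ν) {c : ℝ≥0∞} (hc : c ≠ ∞) :
    SameMoments (c • μ) (c • ν) := by
  refine ⟨h.left.smul_measure hc, h.right.smul_measure hc, fun q hq => ?_⟩
  rw [integral_smul_measure, integral_smul_measure, h.integral_eq q hq]

/-- A quadratic function is a combination of products `L₁ L₂`, linear forms and constants, and `E[L₁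
L₂] = Cov(L₁, L₂) + E[L₁] E[L₂]`. -/
theorem SameMoments.of_covarianceBilinDual [BorelSpace E] [FiniteDimensional ℝ E] {μ ν : Measure E} [IsProbabilityMeasure μ]
    [IsProbabilityMeasure ν] (hμ : MemLp id 2 μ) (hν : MemLp id 2 ν)
    (hm : ∫ x, x ∂μ = ∫ x, x ∂ν) (hc : covarianceBilinDual μ = covarianceBilinDual ν) :
    SameMoments μ ν := by
  refine ⟨hμ, hν, fun q hq => ?_⟩
  have key (P : Measure E) [IsProbabilityMeasure P] (hP : MemLp id 2 P) (L₁ L₂ : E →L[ℝ] ℝ) :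
      ∫ x, L₁ x * L₂ x ∂P
        = covarianceBilinDual P L₁ L₂ + L₁ (∫ x, x ∂P) * L₂ (∫ x, x ∂P) := by
    have hi : Integrable (fun x : E => x) P := hP.integrable one_le_two
    rw [covarianceBilinDual_eq_covariance hP, covariance_eq_sub (memLp_dual_of_memLp_id hP L₁)
      (memLp_dual_of_memLp_id hP L₂), ← L₁.integral_comp_comm hi, ← L₂.integral_comp_comm hi]
    simp
  have key₁ (P : Measure E) [IsProbabilityMeasure P] (hP : MemLp id 2 P) (L : E →L[ℝ] ℝ) :
      ∫ x, L x ∂P = L (∫ x, x ∂P) :=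
    L.integral_comp_comm (hP.integrable one_le_two)
  obtain ⟨n, L₁, L₂, L, c, h⟩ := hq.exists_eq_sum
  have expand (P : Measure E) [IsProbabilityMeasure P] (hP : MemLp id 2 P) :
      ∫ x, q x ∂P = ∑ i, ∫ x, L₁ i x * L₂ i x ∂P + ∫ x, L x ∂P + c := by
    have h₁ : ∀ i ∈ Finset.univ, Integrable (fun x => L₁ i x * L₂ i x) P := fun i _ =>
      (isQuadratic_dual_mul_dual _ _).integrable hP
    have h₂ : Integrable (fun x => L x) P := (isQuadratic_dual L).integrable hP
    simp_rw [h]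
    rw [integral_add (f := fun x => ∑ i, L₁ i x * L₂ i x + L x)
      ((integrable_finsetSum _ h₁).add h₂) (integrable_const c), integral_add (integrable_finsetSum _ h₁) h₂, integral_finsetSum _ h₁]
    simp
  rw [expand μ hμ, expand ν hν, key₁ μ hμ, key₁ ν hν, hm]
  congr 2
  refine Finset.sum_congr rfl fun i _ => ?_
  rw [key μ hμ, key ν hν, hm, hc]

end MomentMatching

/-! ### Measures with density `exp q`, `q` quadratic. -/

section QuadraticLogDensity

/-- `μ` has a density of the form `exp q` with `q` quadratic with respect to `l`. -/
def HasQuadraticLogDensity {E : Type*} [NormedAddCommGroup E] [NormedSpace ℝ E] [MeasurableSpace E]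
    (μ l : Measure E) : Prop :=
  ∃ q : E → ℝ, IsQuadratic q ∧ μ = l.withDensity fun x => ENNReal.ofReal (Real.exp (q x))

variable {E F : Type*} [NormedAddCommGroup E] [NormedSpace ℝ E] [MeasurableSpace E]
  [NormedAddCommGroup F] [NormedSpace ℝ F] [MeasurableSpace F] [BorelSpace F]

theorem IsQuadratic.measurable_ofReal_exp [BorelSpace E] {q : E → ℝ} (hq : IsQuadratic q) :
    Measurable fun x => ENNReal.ofReal (Real.exp (q x)) := by
  have := hq.continuous.measurable
  fun_prop

theorem HasQuadraticLogDensity.of_smul_measure [BorelSpace E] {μ l : Measure E} {c : ℝ≥0∞} (hc₀ : c ≠ 0)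
    (hc : c ≠ ∞) (h : HasQuadraticLogDensity μ (c • l)) : HasQuadraticLogDensity μ l := by
  obtain ⟨q, hq, rfl⟩ := h
  refine ⟨fun x => Real.log c.toReal + q x, (isQuadratic_const _).add hq, ?_⟩
  rw [withDensity_smul_measure, ← withDensity_smul _ hq.measurable_ofReal_exp]
  congr 1
  ext x
  rw [Real.exp_add, Real.exp_log (ENNReal.toReal_pos hc₀ hc),
    ENNReal.ofReal_mul ENNReal.toReal_nonneg, ENNReal.ofReal_toReal hc]
  rfl

theorem HasQuadraticLogDensity.smul [BorelSpace E] {μ l : Measure E} {c : ℝ≥0∞} (hc₀ : c ≠ 0)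
    (hc : c ≠ ∞) (h : HasQuadraticLogDensity μ l) : HasQuadraticLogDensity (c • μ) l := by
  obtain ⟨q, hq, rfl⟩ := h
  refine HasQuadraticLogDensity.of_smul_measure hc₀ hc ⟨q, hq, ?_⟩
  rw [withDensity_smul_measure]

/-- Haar measures are proportional, and the factor goes into the constant term of `q`. This absorbs
the Jacobian of linear changes of variables. -/
theorem HasQuadraticLogDensity.of_addHaar [BorelSpace E] [FiniteDimensional ℝ E] {μ l l' : Measure E} [l.IsAddHaarMeasure]
    [l'.IsAddHaarMeasure] (h : HasQuadraticLogDensity μ l) : HasQuadraticLogDensity μ l' := by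
  have hl : l = l.addHaarScalarFactor l' • l' := Measure.isAddLeftInvariant_eq_smul l l'
  rw [hl] at h
  refine HasQuadraticLogDensity.of_smul_measure (c := (l.addHaarScalarFactor l' : ℝ≥0∞))
    ?_ ENNReal.coe_ne_top h
  exact_mod_cast (Measure.addHaarScalarFactor_pos_of_isAddHaarMeasure l l').ne'

theorem map_withDensity_measurableEquiv {α β : Type*} [MeasurableSpace α] [MeasurableSpace β]
    (e : α ≃ᵐ β) (l : Measure α) (f : α → ℝ≥0∞) :
    (l.withDensity f).map e = (l.map e).withDensity fun y => f (e.symm y) := by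
  ext s hs
  rw [e.map_apply, withDensity_apply _ (e.measurable hs), withDensity_apply _ hs,
    e.restrict_map, lintegral_map_equiv]
  simp

theorem HasQuadraticLogDensity.map_equiv [BorelSpace E] {μ l : Measure E} (h : HasQuadraticLogDensity μ l)
    (e : E ≃L[ℝ] F) : HasQuadraticLogDensity (μ.map e) (l.map e) := by
  obtain ⟨q, hq, rfl⟩ := h
  exact ⟨fun y => q (e.symm y), hq.comp_clm (e.symm : F →L[ℝ] E),
    map_withDensity_measurableEquiv e.toHomeomorph.toMeasurableEquiv l _⟩

theorem HasQuadraticLogDensity.map_const_add [BorelSpace E] {μ l : Measure E} [l.IsAddLeftInvariant]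
    (h : HasQuadraticLogDensity μ l) (b : E) :
    HasQuadraticLogDensity (μ.map (fun x => b + x)) l := by
  obtain ⟨q, hq, rfl⟩ := h
  refine ⟨_, hq.comp_add_const (-b), ?_⟩
  have := map_withDensity_measurableEquiv (MeasurableEquiv.addLeft b) l
    (fun x => ENNReal.ofReal (Real.exp (q x)))
  simpa [map_add_left_eq_self, add_comm] using this

theorem HasQuadraticLogDensity.prod [BorelSpace E] [FiniteDimensional ℝ E] {μ l : Measure E} {ν k : Measure F} [SFinite l] [SFinite k]
    (hμ : HasQuadraticLogDensity μ l) (hν : HasQuadraticLogDensity ν k) :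
    HasQuadraticLogDensity (μ.prod ν) (l.prod k) := by
  obtain ⟨p, hp, rfl⟩ := hμ
  obtain ⟨q, hq, rfl⟩ := hν
  refine ⟨_, (hp.comp_clm (.fst ℝ E F)).add (hq.comp_clm (.snd ℝ E F)), ?_⟩
  rw [prod_withDensity hp.measurable_ofReal_exp hq.measurable_ofReal_exp]
  congr 1
  ext z
  simp [Real.exp_add, ENNReal.ofReal_mul (Real.exp_pos _).le]

theorem HasQuadraticLogDensity.absolutelyContinuous {μ l : Measure E}
    (h : HasQuadraticLogDensity μ l) : μ ≪ l := by
  obtain ⟨q, hq, rfl⟩ := h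
  exact withDensity_absolutelyContinuous _ _

end QuadraticLogDensity

end EUOT

/-! ### Comparison of divergences. -/

namespace EUOT

/-- If `log (dG/dν)` has the same integral against `μ` and `G`, and `μ` and `G` have the same mass,
then `klDiv μ ν - klDiv G ν = klDiv μ G ≥ 0`. -/
theorem klDiv_le_klDiv_of_withDensity {α : Type*} [MeasurableSpace α] {μ G ν : Measure α}
    [IsFiniteMeasure μ] [IsFiniteMeasure G] [IsFiniteMeasure ν] {r : α → ℝ} (hr : Measurable r)
    (hG : G = ν.withDensity fun x => ENNReal.ofReal (Real.exp (r x)))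
    (hrμ : Integrable r μ) (hrG : Integrable r G) (hint : ∫ x, r x ∂μ = ∫ x, r x ∂G)
    (hmass : μ Set.univ = G Set.univ) : klDiv G ν ≤ klDiv μ ν := by
  by_cases htop : klDiv μ ν = ∞
  · rw [htop]
    exact le_top
  obtain ⟨hμν, hllr⟩ := klDiv_ne_top_iff.1 htop
  have hmeas : Measurable fun x => ENNReal.ofReal (Real.exp (r x)) := by fun_prop
  have hGν : G ≪ ν := hG ▸ withDensity_absolutelyContinuous _ _
  have hνG : ν ≪ G := by
    rw [hG]
    exact withDensity_absolutelyContinuous' hmeas.aemeasurable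
      (.of_forall fun x => (ENNReal.ofReal_pos.2 (Real.exp_pos _)).ne')
  have hμG : μ ≪ G := hμν.trans hνG
  have hrn : G.rnDeriv ν =ᵐ[ν] fun x => ENNReal.ofReal (Real.exp (r x)) := by
    conv_lhs => rw [hG]
    exact Measure.rnDeriv_withDensity ν hmeas
  have hGllr : llr G ν =ᵐ[G] r := by
    filter_upwards [hGν.ae_le hrn] with x hx
    rw [llr, hx, ENNReal.toReal_ofReal (Real.exp_pos _).le, Real.log_exp]
  -- Chain rule `dμ/dν = (dμ/dG) (dG/dν)`, in logarithms.
  have hμllr : llr μ G =ᵐ[μ] fun x => llr μ ν x - r x := by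
    filter_upwards [hμν.ae_le hrn, hμν.ae_le (Measure.rnDeriv_mul_rnDeriv (κ := ν) hμG),
      Measure.rnDeriv_pos hμG, hμG.ae_le (Measure.rnDeriv_lt_top μ G)] with x h₁ h₂ h₃ h₄
    rw [llr, llr, ← h₂, Pi.mul_apply, h₁, ENNReal.toReal_mul,
      ENNReal.toReal_ofReal (Real.exp_pos _).le,
      Real.log_mul (ENNReal.toReal_pos h₃.ne' h₄.ne).ne' (Real.exp_pos _).ne', Real.log_exp]
    ring
  have hμGint : Integrable (llr μ G) μ := (hllr.sub hrμ).congr hμllr.symm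
  have hgibbs := integral_llr_add_sub_measure_univ_nonneg hμG hμGint
  rw [integral_congr_ae hμllr, integral_sub hllr hrμ] at hgibbs
  rw [klDiv_of_ac_of_integrable hμν hllr,
    klDiv_of_ac_of_integrable hGν (hrG.congr hGllr.symm), integral_congr_ae hGllr]
  refine ENNReal.ofReal_le_ofReal ?_
  have : μ.real Set.univ = G.real Set.univ := by rw [Measure.real, Measure.real, hmass]
  linarith

/-- With log-densities `p` of `G` and `q` of `ν`, `log (dG/dν) = p - q` is quadratic; the constant
function `1` gives equality of masses. -/
theorem SameMoments.klDiv_le {E : Type*} [NormedAddCommGroup E] [NormedSpace ℝ E]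
    [MeasurableSpace E] [BorelSpace E] [FiniteDimensional ℝ E] {μ G ν l : Measure E}
    [IsFiniteMeasure μ] [IsFiniteMeasure G] [IsFiniteMeasure ν] (h : SameMoments μ G)
    (hG : HasQuadraticLogDensity G l) (hν : HasQuadraticLogDensity ν l) :
    klDiv G ν ≤ klDiv μ ν := by
  obtain ⟨p, hp, hp'⟩ := hG
  obtain ⟨q, hq, hq'⟩ := hν
  refine klDiv_le_klDiv_of_withDensity (hp.sub hq).continuous.measurable ?_
    ((hp.sub hq).integrable h.left) ((hp.sub hq).integrable h.right)
    (h.integral_eq _ (hp.sub hq)) ?_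
  · rw [hq', ← withDensity_mul _ hq.measurable_ofReal_exp (hp.sub hq).measurable_ofReal_exp, hp']
    congr 1
    ext x
    rw [Pi.mul_apply, ← ENNReal.ofReal_mul (Real.exp_pos _).le, ← Real.exp_add, add_sub_cancel]
  · have h₁ := h.integral_eq _ (isQuadratic_const 1)
    simp only [integral_const, smul_eq_mul, mul_one] at h₁
    exact (measureReal_eq_measureReal_iff).1 h₁

/-! ### Gaussian densities and nondegeneracy. -/

section GaussianDensity

theorem hasQuadraticLogDensity_stdGaussian {H : Type*} [NormedAddCommGroup H]
    [InnerProductSpace ℝ H] [FiniteDimensional ℝ H] [MeasurableSpace H] [BorelSpace H] :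
    HasQuadraticLogDensity (stdGaussian H) volume := by
  -- The normalizing constant `(2π)^(n/2) = ∫ exp (-‖x‖²/2)`; the density is then identified through
  -- its characteristic function.
  set K : ℝ := (Real.pi / (1 / 2)) ^ (Module.finrank ℝ H / 2 : ℝ) with hK
  have hKpos : 0 < K := by positivity
  have hq : IsQuadratic fun x : H => -Real.log K + (-(1 / 2)) * ‖x‖ ^ 2 :=
    (isQuadratic_const _).add (isQuadratic_norm_sq.const_mul _)
  refine ⟨_, hq, ?_⟩
  have hexp (x : H) : Real.exp (-Real.log K + (-(1 / 2)) * ‖x‖ ^ 2)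
      = K⁻¹ * Real.exp (-(1 / 2) * ‖x‖ ^ 2) := by
    rw [Real.exp_add, Real.exp_neg, Real.exp_log hKpos]
  have hint : Integrable (fun x : H => Real.exp (-Real.log K + (-(1 / 2)) * ‖x‖ ^ 2)) := by
    simp_rw [hexp]
    -- A nonintegrable function has integral `0` by convention, so a nonzero integral gives
    -- integrability.
    refine Integrable.const_mul (Integrable.of_integral_ne_zero ?_) _
    rw [GaussianFourier.integral_rexp_neg_mul_sq_norm (by norm_num)]
    exact hKpos.ne'
  have : IsFiniteMeasure (volume.withDensity fun x : H =>
      ENNReal.ofReal (Real.exp (-Real.log K + (-(1 / 2)) * ‖x‖ ^ 2))) :=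
    isFiniteMeasure_withDensity_ofReal hint.2
  refine Measure.ext_of_charFun ?_
  ext t
  rw [charFun_stdGaussian, charFun_apply,
    integral_withDensity_eq_integral_toReal_smul hq.measurable_ofReal_exp
      (.of_forall fun _ => ENNReal.ofReal_lt_top)]
  have hfun (x : H) : (ENNReal.ofReal (Real.exp (-Real.log K + (-(1 / 2)) * ‖x‖ ^ 2))).toReal •
      Complex.exp (inner ℝ x t * Complex.I) = (K⁻¹ : ℂ) *
        Complex.exp (-(1 / 2 : ℂ) * ‖x‖ ^ 2 + Complex.I * inner ℝ t x) := by
    rw [ENNReal.toReal_ofReal (Real.exp_pos _).le, hexp, Complex.exp_add, real_inner_comm,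
      Complex.real_smul]
    push_cast
    ring_nf
  simp_rw [hfun]
  rw [integral_const_mul, GaussianFourier.integral_cexp_neg_mul_sq_norm_add (by norm_num)]
  have hKc : (K : ℂ) = (Real.pi / (1 / 2 : ℂ)) ^ (Module.finrank ℝ H / 2 : ℂ) := by
    rw [hK, Complex.ofReal_cpow (by positivity)]
    push_cast
    rfl
  rw [← hKc, ← mul_assoc, inv_mul_cancel₀ (by exact_mod_cast hKpos.ne'), one_mul]
  congr 1
  rw [Complex.I_sq]
  ring

variable {ι : Type*} [Fintype ι] [DecidableEq ι]

/-- The standard Gaussian is pushed forward by `√S`, invertible because `S` is positive definite,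
and translated by `m`. -/
theorem hasQuadraticLogDensity_multivariateGaussian (m : EuclideanSpace ℝ ι) {S : Matrix ι ι ℝ}
    (hS : S.PosDef) : HasQuadraticLogDensity (multivariateGaussian m S) volume := by
  open scoped MatrixOrder in
  have hsqrt : CFC.sqrt S * CFC.sqrt S = S := CFC.sqrt_mul_sqrt_self _ hS.posSemidef.nonneg
  have hunit : IsUnit (CFC.sqrt S) := by
    have := hS.isUnit
    rw [← hsqrt] at this
    exact isUnit_of_mul_isUnit_left this
  let A := Matrix.toEuclideanCLM (𝕜 := ℝ) (CFC.sqrt S)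
  obtain ⟨u, hu⟩ : IsUnit A := hunit.map (Matrix.toEuclideanCLM (n := ι) (𝕜 := ℝ))
  let e := ContinuousLinearEquiv.ofUnit u
  have he : ⇑e = A := by
    rw [← hu]
    rfl
  have h := (hasQuadraticLogDensity_stdGaussian (H := EuclideanSpace ℝ ι)).map_equiv e
  have h' := (h.of_addHaar (l' := volume)).map_const_add m
  rw [he, Measure.map_map (by fun_prop) (by fun_prop)] at h'
  exact h'

/-- The covariance matrix of a measure on `ℝ^ι`. -/
noncomputable def covMatrix (P : Measure (EuclideanSpace ℝ ι)) : Matrix ι ι ℝ :=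
  Matrix.of fun i j => cov[fun x => x i, fun x => x j; P]

omit [DecidableEq ι] in
theorem covarianceBilin_eq_dotProduct_covMatrix {P : Measure (EuclideanSpace ℝ ι)}
    [IsFiniteMeasure P] (hP : MemLp id 2 P) (x y : EuclideanSpace ℝ ι) :
    covarianceBilin P x y = x.ofLp ⬝ᵥ (covMatrix P).mulVec y.ofLp := by
  have h := covarianceBilin_apply_pi (μ := P) (X := fun i (x : EuclideanSpace ℝ ι) => x i)
    (fun i => hP.eval_piLp i) x y
  have hid : P.map (fun ω => WithLp.toLp 2 fun i => ω i) = P := Measure.map_id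
  rw [hid] at h
  rw [h]
  simp only [dotProduct, Matrix.mulVec, covMatrix, Matrix.of_apply, Finset.mul_sum]
  refine Finset.sum_congr rfl fun i _ => Finset.sum_congr rfl fun j _ => ?_
  ring

omit [DecidableEq ι] in
theorem posSemidef_covMatrix {P : Measure (EuclideanSpace ℝ ι)}
    [IsFiniteMeasure P] (hP : MemLp id 2 P) : (covMatrix P).PosSemidef := by
  refine Matrix.PosSemidef.of_dotProduct_mulVec_nonneg ?_ fun x => ?_
  · ext i j
    simp [covMatrix, covariance_comm]
  · have := covarianceBilin_self_nonneg (μ := P) (WithLp.toLp 2 x)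
    rwa [covarianceBilin_eq_dotProduct_covMatrix hP] at this

theorem covarianceBilin_multivariateGaussian_covMatrix {P : Measure (EuclideanSpace ℝ ι)}
    [IsFiniteMeasure P] (hP : MemLp id 2 P) (m : EuclideanSpace ℝ ι) :
    covarianceBilin (multivariateGaussian m (covMatrix P)) = covarianceBilin P := by
  ext x y
  rw [covarianceBilin_multivariateGaussian (posSemidef_covMatrix hP),
    covarianceBilin_eq_dotProduct_covMatrix hP]

/-- The Gaussian measure with the mean and covariance matrix of `P` has the moments of `P`. -/
theorem sameMoments_multivariateGaussian {P : Measure (EuclideanSpace ℝ ι)}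
    [IsProbabilityMeasure P] (hP : MemLp id 2 P) :
    SameMoments P (multivariateGaussian (∫ x, x ∂P) (covMatrix P)) := by
  refine SameMoments.of_covarianceBilinDual hP IsGaussian.memLp_two_id (by simp) ?_
  have h := (covarianceBilin_multivariateGaussian_covMatrix hP (∫ x, x ∂P)).symm
  ext L₁ L₂
  have h' := congr($h ((InnerProductSpace.toDual ℝ _).symm L₁)
    ((InnerProductSpace.toDual ℝ _).symm L₂))
  have hdual (L : StrongDual ℝ (EuclideanSpace ℝ ι)) : InnerProductSpace.toDualMap ℝ _
      ((InnerProductSpace.toDual ℝ (EuclideanSpace ℝ ι)).symm L) = L :=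
    (InnerProductSpace.toDual ℝ (EuclideanSpace ℝ ι)).apply_symm_apply L
  rwa [covarianceBilin_eq_covarianceBilinDual, covarianceBilin_eq_covarianceBilinDual, hdual,
    hdual] at h'

/-- A Gaussian is determined by its mean and covariance matrix `C`; as `xᵀ C x` is the variance of
`⟨x, ·⟩`, the hypothesis makes `C` positive definite. -/
theorem hasQuadraticLogDensity_of_isGaussian_euclidean (Q : Measure (EuclideanSpace ℝ ι))
    [IsGaussian Q] (hQ : ∀ L : EuclideanSpace ℝ ι →L[ℝ] ℝ, L ≠ 0 → Var[fun x => L x; Q] ≠ 0) :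
    HasQuadraticLogDensity Q volume := by
  have hmem : MemLp id 2 Q := IsGaussian.memLp_two_id
  have hQeq : Q = multivariateGaussian (∫ x, x ∂Q) (covMatrix Q) :=
    IsGaussian.ext (by simp) (covarianceBilin_multivariateGaussian_covMatrix hmem _).symm
  rw [hQeq]
  refine hasQuadraticLogDensity_multivariateGaussian _ ?_
  refine Matrix.PosDef.of_dotProduct_mulVec_pos (posSemidef_covMatrix hmem).isHermitian
    fun x hx => ?_
  have hval := covarianceBilin_eq_dotProduct_covMatrix hmem (WithLp.toLp 2 x) (WithLp.toLp 2 x)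
  simp only [star_trivial]
  rw [← hval]
  refine lt_of_le_of_ne (covarianceBilin_self_nonneg _) (Ne.symm ?_)
  rw [covarianceBilin_self hmem]
  refine hQ (innerSL ℝ (WithLp.toLp 2 x)) fun h => hx ?_
  have := congr($h (WithLp.toLp 2 x))
  simpa using this

variable {E : Type*} [NormedAddCommGroup E] [NormedSpace ℝ E] [MeasurableSpace E] [BorelSpace E]
  [FiniteDimensional ℝ E]

/-- Linear coordinates reduce this to the Euclidean case; `Rd d × Rd d` carries the sup norm, so it
is not itself Euclidean. -/
theorem hasQuadraticLogDensity_of_isGaussian (Q l : Measure E) [IsGaussian Q]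
    [l.IsAddHaarMeasure] (hQ : ∀ L : E →L[ℝ] ℝ, L ≠ 0 → Var[fun x => L x; Q] ≠ 0) :
    HasQuadraticLogDensity Q l := by
  obtain ⟨e⟩ : Nonempty (E ≃L[ℝ] EuclideanSpace ℝ (Fin (Module.finrank ℝ E))) := ⟨toEuclidean⟩
  have h : HasQuadraticLogDensity (Q.map e) volume := by
    refine hasQuadraticLogDensity_of_isGaussian_euclidean _ fun L hL => ?_
    rw [variance_map (by fun_prop) (by fun_prop)]
    have hne : L.comp e.toContinuousLinearMap ≠ 0 := fun h0 => hL <| by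
      refine ContinuousLinearMap.ext fun x => ?_
      have := DFunLike.congr_fun h0 (e.symm x)
      rwa [ContinuousLinearMap.comp_apply, ContinuousLinearEquiv.coe_coe,
        e.apply_symm_apply] at this
    have hcomp : (fun x => L x) ∘ e = fun x => L.comp e.toContinuousLinearMap x := by
      funext x
      rw [ContinuousLinearMap.comp_apply, ContinuousLinearEquiv.coe_coe, Function.comp_apply]
    rw [hcomp]
    exact hQ _ hne
  have h' := (h.map_equiv e.symm).of_addHaar (l' := l)
  rw [Measure.map_map (by fun_prop) (by fun_prop)] at h'
  simpa using h'

/-- A measure that charges no hyperplane is not concentrated on one. -/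
theorem variance_dual_ne_zero {P l : Measure E} [IsProbabilityMeasure P] [l.IsAddHaarMeasure]
    (hP : MemLp id 2 P) (hPl : P ≪ l) {L : E →L[ℝ] ℝ} (hL : L ≠ 0) :
    Var[fun x => L x; P] ≠ 0 := by
  intro h0
  have hae := ae_eq_integral_of_variance_eq_zero (memLp_dual_of_memLp_id hP L) h0
  set a := ∫ x, L x ∂P
  obtain ⟨v, hv⟩ : ∃ v, L v ≠ 0 := by
    by_contra! hcon
    exact hL (ContinuousLinearMap.ext hcon)
  -- The level set `{L = a}`: it carries all of `P` when the variance vanishes, but it is null for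
  -- `l`.
  let s : AffineSubspace ℝ E :=
    (AffineSubspace.mk' a (⊥ : Submodule ℝ ℝ)).comap (L : E →ₗ[ℝ] ℝ).toAffineMap
  have hmem (x : E) : x ∈ s ↔ L x = a := by
    simp [s, AffineSubspace.mem_comap, sub_eq_zero]
  have hs : s ≠ ⊤ := by
    intro hs
    have h₁ : ∀ x, L x = a := fun x => (hmem x).1 (hs ▸ AffineSubspace.mem_top ℝ E x)
    exact hv (by rw [h₁ v, ← h₁ 0, map_zero])
  have hzero : P s = 0 := hPl (Measure.addHaar_affineSubspace l s hs)
  have hone : P (s : Set E)ᶜ = 0 := by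
    rw [← mem_ae_iff]
    filter_upwards [hae] with x hx
    exact (hmem x).2 hx
  have : P Set.univ = 0 := by
    rw [← Set.union_compl_self (s : Set E)]
    exact measure_union_null hzero hone
  simp at this

/-- Replacing a finite measure by the Gaussian measure with the same mass, mean and covariance does
not increase the divergence from a nondegenerate Gaussian measure. -/
theorem SameMoments.klDiv_gaussian_le {P Q ν l : Measure E} [IsProbabilityMeasure P]
    [IsGaussian Q] [IsFiniteMeasure ν] [l.IsAddHaarMeasure] (h : SameMoments P Q)
    (hν : HasQuadraticLogDensity ν l) {c : ℝ≥0∞} (hc₀ : c ≠ 0) (hc : c ≠ ∞) :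
    klDiv (c • Q) ν ≤ klDiv (c • P) ν := by
  have := Measure.smul_finite P hc
  have := Measure.smul_finite Q hc
  by_cases htop : klDiv (c • P) ν = ∞
  · rw [htop]
    exact le_top
  -- Finiteness of the divergence is what rules out a degenerate `Q`.
  have hPl : P ≪ l :=
    ((Measure.absolutelyContinuous_smul hc₀).trans (klDiv_ne_top_iff.1 htop).1).trans
      hν.absolutelyContinuous
  refine (h.smul hc).klDiv_le (HasQuadraticLogDensity.smul hc₀ hc ?_) hν
  refine hasQuadraticLogDensity_of_isGaussian Q l fun L hL => ?_
  rw [variance_eq_sub (memLp_dual_of_memLp_id h.right L)]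
  -- `L` has the same variance under `Q` as under `P`, where it is nonzero.
  have h₂ : ∫ x, ((fun x => L x) ^ 2) x ∂P = ∫ x, ((fun x => L x) ^ 2) x ∂Q := by
    simpa [pow_two] using h.integral_eq _ (isQuadratic_dual_mul_dual L L)
  rw [← h₂, ← h.integral_eq _ (isQuadratic_dual L),
    ← variance_eq_sub (memLp_dual_of_memLp_id h.left L)]
  exact variance_dual_ne_zero h.left hPl hL

end GaussianDensity

end EUOT

/-! ### Plans on `ℝ^d × ℝ^d` and their joint Gaussians. -/

namespace EUOT

variable {d : ℕ}

/-- The identification `split` as a continuous linear equivalence. -/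
noncomputable def splitCLE (d : ℕ) : EuclideanSpace ℝ (Fin d ⊕ Fin d) ≃L[ℝ] Rd d × Rd d :=
  LinearEquiv.toContinuousLinearEquiv
    { toFun := split
      invFun := fun z => WithLp.toLp 2 (Sum.elim z.1 z.2)
      map_add' := fun _ _ => rfl
      map_smul' := fun _ _ => rfl
      left_inv := fun w => by
        ext i
        cases i <;> rfl
      right_inv := fun _ => rfl }

theorem coe_splitCLE : ⇑(splitCLE d) = split := rfl

theorem splitCLE_symm_apply (z : Rd d × Rd d) :
    (splitCLE d).symm z = WithLp.toLp 2 (Sum.elim z.1 z.2) := rfl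

theorem enorm_sq_prod_le (z : Rd d × Rd d) : ‖z‖ₑ ^ 2 ≤ ‖z.1‖ₑ ^ 2 + ‖z.2‖ₑ ^ 2 := by
  have hz : ‖z‖ₑ = max ‖z.1‖ₑ ‖z.2‖ₑ := by simp [enorm, Prod.nnnorm_def]
  rcases max_cases ‖z.1‖ₑ ‖z.2‖ₑ with h | h
  · rw [hz, h.1]
    exact le_self_add
  · rw [hz, h.1]
    exact le_add_self

theorem memLp_two_iff_lintegral_enorm_sq {α E : Type*} [MeasurableSpace α] [NormedAddCommGroup E]
    {μ : Measure α} {f : α → E} (hf : AEStronglyMeasurable f μ) :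
    MemLp f 2 μ ↔ ∫⁻ x, ‖f x‖ₑ ^ 2 ∂μ < ∞ := by
  have h := eLpNorm_lt_top_iff_lintegral_rpow_enorm_lt_top (f := f) (μ := μ) two_ne_zero
    ENNReal.ofNat_ne_top
  simp only [ENNReal.toReal_ofNat, ENNReal.rpow_ofNat] at h
  exact ⟨fun hm => h.1 hm.2, fun hi => ⟨hf, h.2 hi⟩⟩

theorem isPlan_iff {π : Measure (Rd d × Rd d)} : IsPlan π ↔ IsFiniteMeasure π ∧ MemLp id 2 π := by
  refine and_congr_right fun _ => ?_
  rw [lintegral_add_left (by fun_prop), ENNReal.add_lt_top,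
    ← memLp_two_iff_lintegral_enorm_sq (by fun_prop),
    ← memLp_two_iff_lintegral_enorm_sq (by fun_prop)]
  refine ⟨fun ⟨h₁, h₂⟩ => ?_, fun h => ?_⟩
  · rw [memLp_two_iff_lintegral_enorm_sq aestronglyMeasurable_id] at *
    refine (lintegral_mono fun z => enorm_sq_prod_le z).trans_lt ?_
    rw [lintegral_add_left (by fun_prop)]
    rw [memLp_two_iff_lintegral_enorm_sq (by fun_prop)] at h₁ h₂
    exact ENNReal.add_lt_top.2 ⟨h₁, h₂⟩
  · exact ⟨(ContinuousLinearMap.fst ℝ (Rd d) (Rd d)).comp_memLp' h,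
      (ContinuousLinearMap.snd ℝ (Rd d) (Rd d)).comp_memLp' h⟩

theorem covMatrix_map_splitCLE_symm {P : Measure (Rd d × Rd d)} :
    covMatrix (P.map (splitCLE d).symm) = jointCov P := by
  have h (i j : Fin d ⊕ Fin d) : covMatrix (P.map (splitCLE d).symm) i j
      = cov[fun z => (splitCLE d).symm z i, fun z => (splitCLE d).symm z j; P] := by
    simp only [covMatrix, Matrix.of_apply]
    exact covariance_map_fun (by fun_prop) (by fun_prop) (by fun_prop)
  ext i j
  rw [h]
  rcases i with i | i <;> rcases j with j | j <;>
    simp [jointCov, splitCLE_symm_apply]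
  -- The block `Σ₃ᵀ`, the only one where the order of the arguments is reversed.
  exact covariance_comm _ _

theorem integral_map_splitCLE_symm {P : Measure (Rd d × Rd d)} (hP : Integrable (fun z => z) P) :
    ∫ w, w ∂(P.map (splitCLE d).symm)
      = WithLp.toLp 2 (Sum.elim (jointMean P).1 (jointMean P).2) := by
  rw [integral_map (by fun_prop) (by fun_prop), ContinuousLinearEquiv.integral_comp_comm,
    ← splitCLE_symm_apply]
  congr 1
  exact Prod.ext (fst_integral hP) (snd_integral hP)

instance isGaussian_jointGaussian (m : Rd d × Rd d)
    (S : Matrix (Fin d ⊕ Fin d) (Fin d ⊕ Fin d) ℝ) : IsGaussian (jointGaussian m S) := by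
  unfold jointGaussian
  rw [← coe_splitCLE]
  infer_instance

theorem sameMoments_jointGaussian {P : Measure (Rd d × Rd d)} [IsProbabilityMeasure P]
    (hP : MemLp id 2 P) : SameMoments P (jointGaussian (jointMean P) (jointCov P)) := by
  have hm : MemLp id 2 (P.map (splitCLE d).symm) := by
    rw [memLp_map_measure_iff aestronglyMeasurable_id (by fun_prop)]
    exact (splitCLE d).symm.toContinuousLinearMap.comp_memLp' hP
  have : IsProbabilityMeasure (P.map (splitCLE d).symm) :=
    Measure.isProbabilityMeasure_map (by fun_prop)
  have h := (sameMoments_multivariateGaussian hm).map (splitCLE d : _ →L[ℝ] Rd d × Rd d)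
  rw [integral_map_splitCLE_symm (hP.integrable one_le_two), covMatrix_map_splitCLE_symm] at h
  have hPP : (P.map (splitCLE d).symm).map (splitCLE d : _ →L[ℝ] Rd d × Rd d) = P := by
    rw [Measure.map_map (by fun_prop) (by fun_prop)]
    convert! Measure.map_id
  rwa [hPP] at h

theorem hasQuadraticLogDensity_scaledGaussian {c : ℝ} (hc : 0 < c) (m : Rd d)
    {S : Matrix (Fin d) (Fin d) ℝ} (hS : S.PosDef) :
    HasQuadraticLogDensity (scaledGaussian c m S) volume :=
  (hasQuadraticLogDensity_multivariateGaussian m hS).smul (ENNReal.ofReal_pos.2 hc).ne'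
    ENNReal.ofReal_ne_top

instance isFiniteMeasure_scaledGaussian (c : ℝ) (m : Rd d) (S : Matrix (Fin d) (Fin d) ℝ) :
    IsFiniteMeasure (scaledGaussian c m S) :=
  Measure.smul_finite _ ENNReal.ofReal_ne_top

theorem SameMoments.lintegral_cost_eq {μ ν : Measure (Rd d × Rd d)} [IsFiniteMeasure μ]
    [IsFiniteMeasure ν] (h : SameMoments μ ν) :
    ∫⁻ z, ‖z.2 - z.1‖ₑ ^ 2 ∂μ = ∫⁻ z, ‖z.2 - z.1‖ₑ ^ 2 ∂ν := by
  have hq : IsQuadratic fun z : Rd d × Rd d => ‖z.2 - z.1‖ ^ 2 :=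
    isQuadratic_norm_sq.comp_clm
      (ContinuousLinearMap.snd ℝ (Rd d) (Rd d) - ContinuousLinearMap.fst ℝ (Rd d) (Rd d))
  have key (P : Measure (Rd d × Rd d)) [IsFiniteMeasure P] (hP : MemLp id 2 P) :
      ∫⁻ z, ‖z.2 - z.1‖ₑ ^ 2 ∂P = ENNReal.ofReal (∫ z, ‖z.2 - z.1‖ ^ 2 ∂P) := by
    rw [ofReal_integral_eq_lintegral_ofReal (hq.integrable hP) (.of_forall fun _ => sq_nonneg _)]
    simp_rw [ENNReal.ofReal_pow (norm_nonneg _), ofReal_norm]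
  rw [key μ h.left, key ν h.right, h.integral_eq _ hq]

end EUOT

/-! ### The inequality for the objective. -/

theorem mainTheorem9 (d : ℕ) (cα cβ : ℝ) (hcα : 0 < cα) (hcβ : 0 < cβ)
    (mα mβ : EUOT.Rd d) (Sα Sβ : Matrix (Fin d) (Fin d) ℝ) (hSα : Sα.PosDef) (hSβ : Sβ.PosDef)
    (σ γ : ℝ) (hσ : 0 < σ) (hγ : 0 < γ)
    (π : Measure (EUOT.Rd d × EUOT.Rd d)) (hπ : EUOT.IsPlan π) :
    EUOT.IsPlan (EUOT.gaussianPlan π) ∧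
      EUOT.objective σ γ (EUOT.scaledGaussian cα mα Sα) (EUOT.scaledGaussian cβ mβ Sβ)
          (EUOT.gaussianPlan π) ≤
        EUOT.objective σ γ (EUOT.scaledGaussian cα mα Sα) (EUOT.scaledGaussian cβ mβ Sβ) π := by
  have hπ' := hπ
  obtain ⟨hfin, hmem⟩ := EUOT.isPlan_iff.1 hπ'
  -- A plan of mass zero cannot be normalized to a probability measure.
  by_cases h0 : π Set.univ = 0
  · have hG : EUOT.gaussianPlan π = 0 := by simp [EUOT.gaussianPlan, h0]
    have hz : π = 0 := Measure.measure_univ_eq_zero.1 h0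
    rw [hG]
    exact hz ▸ ⟨hπ, le_rfl⟩
  have htop : π Set.univ ≠ ∞ := measure_ne_top _ _
  set c := π Set.univ with hc
  set P := EUOT.normalize π with hP
  have hprob : IsProbabilityMeasure P := by
    refine ⟨?_⟩
    rw [hP, EUOT.normalize, Measure.smul_apply, smul_eq_mul, ENNReal.inv_mul_cancel h0 htop]
  have hπP : c • P = π := by
    rw [hP, EUOT.normalize, smul_smul, ENNReal.mul_inv_cancel h0 htop, one_smul]
  have hPmem : MemLp id 2 P := hmem.smul_measure (ENNReal.inv_ne_top.2 h0)
  have hsm := EUOT.sameMoments_jointGaussian hPmem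
  have hGdef : EUOT.gaussianPlan π
      = c • EUOT.jointGaussian (EUOT.jointMean P) (EUOT.jointCov P) := rfl
  set Q := EUOT.jointGaussian (EUOT.jointMean P) (EUOT.jointCov P)
  have hfinP := Measure.smul_finite P htop
  have hfinQ := Measure.smul_finite Q htop
  have hα := EUOT.hasQuadraticLogDensity_scaledGaussian hcα mα hSα
  have hβ := EUOT.hasQuadraticLogDensity_scaledGaussian hcβ mβ hSβ
  refine ⟨EUOT.isPlan_iff.2 (hGdef ▸ ⟨hfinQ, (hsm.smul htop).right⟩), ?_⟩
  rw [hGdef, ← hπP, EUOT.objective, EUOT.objective, (hsm.smul htop).lintegral_cost_eq]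
  -- The mass comes out of the marginals, leaving images of `P` and `Q` under linear projections.
  simp only [Measure.map_smul]
  have h₁ := hsm.map (ContinuousLinearMap.fst ℝ (EUOT.Rd d) (EUOT.Rd d))
  have h₂ := hsm.map (ContinuousLinearMap.snd ℝ (EUOT.Rd d) (EUOT.Rd d))
  have hP₁ : IsProbabilityMeasure (P.map (ContinuousLinearMap.fst ℝ (EUOT.Rd d) (EUOT.Rd d))) :=
    Measure.isProbabilityMeasure_map (by fun_prop)
  have hP₂ : IsProbabilityMeasure (P.map (ContinuousLinearMap.snd ℝ (EUOT.Rd d) (EUOT.Rd d))) :=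
    Measure.isProbabilityMeasure_map (by fun_prop)
  gcongr
  · exact hsm.klDiv_gaussian_le (hα.prod hβ) h0 htop
  · exact h₁.klDiv_gaussian_le hα h0 htop
  · exact h₂.klDiv_gaussian_le hβ h0 htop
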